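/- An ordered deck of $n$ cards labelled $1,\dots,n$ (card $1$ on top) is shelf-shuffled once with a single shelf: the cards are drawn one by one from the bottom of the deck (in the order $n,n-1,\dots,1$), and each drawn card is placed, independently and with probability $\tfrac12$ each, on the top or at the bottom of the pile formed so far. Then the cards of the shuffled deck are drawn one after the other from the top. Before each draw the guesser guesses the label of the next card, where the guess may depend on all cards shown so far (full feedback); after the guess the card is shown. A guessing strategy is called optimal if it maximizes the expected number of correct guesses. Let $X_n$ be the number of correct guesses when the guesser uses an optimal strategy. Theorem. For any choice, for each $n$, of an optimal strategy, the sequence $X_n$ satisfies the central limit theorem \[ \frac{X_n-\frac34 n}{\sqrt n/4}\;\xrightarrow{d}\;\mathcal N(0,1)\qquad (n\to\infty), \] i.e. the left-hand side converges in distribution to a standard normal random variable. -/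

import Mathlib

open MeasureTheory ProbabilityTheory Filter

noncomputable section

/-- The shuffled deck, listed from top to bottom, produced by a single-shelf shuffle of the ordered
deck `1, 2, …, n`. The cards are drawn from the bottom of the ordered deck, i.e. in the order
`n, n - 1, …, 1`; card `i + 1` is put on top of the current pile if its coin `ω i` is `true`, and
below the current pile otherwise. (`foldr` over `[0, 1, …, n - 1]` treats `n - 1` first.) -/
def shelfDeck (n : ℕ) (ω : Fin n → Bool) : List ℕ :=
  (List.finRange n).foldr
    (fun i pile => if ω i then ((i : ℕ) + 1) :: pile else pile ++ [(i : ℕ) + 1]) []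

/-- The law of the `n` independent fair coins that drive the shuffle. -/
def coinMeasure (n : ℕ) : Measure (Fin n → Bool) :=
  (PMF.uniformOfFintype (Fin n → Bool)).toMeasure

instance (n : ℕ) : IsProbabilityMeasure (coinMeasure n) := by
  unfold coinMeasure; infer_instance

/-- A guessing strategy with full feedback: it maps the list of the cards shown so far
(in the order in which they were shown) to the label guessed for the next card. -/
abbrev Strategy : Type := List ℕ → ℕ

/-- The number of correct guesses when the cards of `deck` are drawn one after the other from the
top: the guess `g (deck.take k)`, made after the first `k` cards have been shown, is correct if it
is the next card of the deck. -/
def correctGuesses (g : Strategy) (deck : List ℕ) : ℕ :=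
  ((Finset.range deck.length).filter fun k => deck[k]? = some (g (deck.take k))).card

/-- The number of correct guesses with strategy `g` after one single-shelf shuffle of `n` cards,
as a random variable on the space of coin tosses. -/
def numCorrect (n : ℕ) (g : Strategy) (ω : Fin n → Bool) : ℕ :=
  correctGuesses g (shelfDeck n ω)

/-- A strategy is optimal for `n` cards if it maximizes the expected number of correct guesses. -/
def IsOptimal (n : ℕ) (g : Strategy) : Prop :=
  ∀ g' : Strategy,
    ∫ ω, (numCorrect n g' ω : ℝ) ∂coinMeasure n ≤ ∫ ω, (numCorrect n g ω : ℝ) ∂coinMeasure n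

end

/-! The shuffled deck shows the top cards in increasing order, then card `n`, then the bottom cards
in decreasing order (`shelfDeck_succ_eq`). Once `n` has been seen, the rest is determined and an
optimal guesser makes no more mistakes. Before that, if the last card shown is `j`, the next one is
`j + 1` with probability 1/2, and any other label is strictly less likely as long as at least three
cards exceed `j` (`isOptimal_topCards`). So, up to the two largest cards, the misses are exactly the
top cards whose predecessor went to the bottom (`isGuessed_iff_of_isOptimal`).

These ascents of the coin sequence make up half of its changes, up to rounding (`card_ascents_le`),
and the changes are again independent fair coins (`coinChanges_bijective`). Hence `X_n` is `n - C /
2` up to a bounded error, with `C` binomial of parameters `n` and 1/2. The central limit theorem for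
fair signs, transferred through characteristic functions, finishes the proof. -/

/-! ### Shape of the shuffled deck -/

/-- The shelf pile obtained from the pile `init` by drawing the cards in `l` from its end. -/
def shelfPile {n : ℕ} (ω : Fin n → Bool) (init : List ℕ) (l : List (Fin n)) : List ℕ :=
  l.foldr (fun i pile => if ω i then ((i : ℕ) + 1) :: pile else pile ++ [(i : ℕ) + 1]) init

lemma shelfPile_eq {n : ℕ} (ω : Fin n → Bool) (init : List ℕ) (l : List (Fin n)) :
    shelfPile ω init l = (l.filter fun i => ω i).map (fun i : Fin n => (i : ℕ) + 1) ++
      (init ++ ((l.filter fun i => !ω i).map (fun i : Fin n => (i : ℕ) + 1)).reverse) := by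
  induction l with
  | nil => simp [shelfPile]
  | cons i l ih =>
    have : shelfPile ω init (i :: l) = if ω i then ((i : ℕ) + 1) :: shelfPile ω init l
      else shelfPile ω init l ++ [(i : ℕ) + 1] := rfl
    rw [this, ih]
    cases h : ω i <;> simp [h]

lemma shelfPile_append {n : ℕ} (ω : Fin n → Bool) (init : List ℕ) (l₁ l₂ : List (Fin n)) :
    shelfPile ω init (l₁ ++ l₂) = shelfPile ω (shelfPile ω init l₂) l₁ := by
  simp [shelfPile]

lemma shelfDeck_eq_shelfPile (n : ℕ) (ω : Fin n → Bool) :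
    shelfDeck n ω = shelfPile ω [] (List.finRange n) := rfl

lemma shelfPile_perm {n : ℕ} (ω : Fin n → Bool) (l : List (Fin n)) :
    (shelfPile ω [] l).Perm (l.map fun i : Fin n => (i : ℕ) + 1) := by
  rw [shelfPile_eq, List.nil_append]
  refine ((List.reverse_perm _).append_left _).trans ?_
  rw [← List.map_append]
  exact (List.filter_append_perm _ l).map _

lemma shelfDeck_nodup (n : ℕ) (ω : Fin n → Bool) : (shelfDeck n ω).Nodup := by
  rw [shelfDeck_eq_shelfPile, (shelfPile_perm ω _).nodup_iff]
  refine (List.nodup_finRange n).map fun i j h => ?_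
  simpa [Fin.ext_iff] using h

lemma mem_shelfDeck {n : ℕ} (ω : Fin n → Bool) (c : ℕ) :
    c ∈ shelfDeck n ω ↔ ∃ i : Fin n, (i : ℕ) + 1 = c := by
  rw [shelfDeck_eq_shelfPile, (shelfPile_perm ω _).mem_iff]
  simp

lemma exists_finRange_split {n : ℕ} (i : Fin n) :
    ∃ l₁ l₂ : List (Fin n), List.finRange n = l₁ ++ i :: l₂ ∧
      (∀ k, k ∈ l₁ ↔ k < i) ∧ (∀ k, k ∈ l₂ ↔ i < k) := by
  obtain ⟨l₁, l₂, h⟩ := List.append_of_mem (List.mem_finRange i)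
  have hs : (List.finRange n).Pairwise (· < ·) := List.pairwise_lt_finRange n
  rw [h, List.pairwise_append, List.pairwise_cons] at hs
  obtain ⟨-, ⟨h2, -⟩, h3⟩ := hs
  have hm : ∀ k, k ∈ l₁ ∨ k = i ∨ k ∈ l₂ := fun k => by
    have := List.mem_finRange k
    rw [h] at this
    simpa using this
  refine ⟨l₁, l₂, h, fun k => ⟨fun hk => h3 k hk i (by simp), fun hk => ?_⟩,
    fun k => ⟨fun hk => h2 k hk, fun hk => ?_⟩⟩
  · rcases hm k with h' | rfl | h'
    · exact h'
    · exact absurd hk (lt_irrefl _)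
    · exact absurd (h2 k h') (not_lt.2 hk.le)
  · rcases hm k with h' | rfl | h'
    · exact absurd (h3 k h' i (by simp)) (not_lt.2 hk.le)
    · exact absurd hk (lt_irrefl _)
    · exact h'

/-- The labels, in increasing order, of the cards `i + 1` with `i < j` that were put on top. -/
def topCards {n : ℕ} (ω : Fin n → Bool) (j : ℕ) : List ℕ :=
  ((List.finRange n).filter fun k : Fin n => decide ((k : ℕ) < j) && ω k).map fun k : Fin n => (k : ℕ) + 1

lemma mem_topCards {n : ℕ} (ω : Fin n → Bool) (j c : ℕ) :
    c ∈ topCards ω j ↔ ∃ k : Fin n, (k : ℕ) < j ∧ ω k = true ∧ (k : ℕ) + 1 = c := by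
  simp [topCards, and_assoc]

lemma topCards_congr {n : ℕ} {ω ω' : Fin n → Bool} {j : ℕ}
    (h : ∀ k : Fin n, (k : ℕ) < j → ω k = ω' k) : topCards ω j = topCards ω' j := by
  unfold topCards
  congr 1
  refine List.filter_congr fun k _ => ?_
  by_cases hk : (k : ℕ) < j <;> simp [hk, h]

lemma topCards_succ_of_false {n : ℕ} {ω : Fin n → Bool} (j : Fin n) (h : ω j = false) :
    topCards ω (j + 1) = topCards ω j := by
  unfold topCards
  congr 1
  refine List.filter_congr fun k _ => ?_
  rcases lt_trichotomy k j with hk | rfl | hk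
  · have : (k : ℕ) < j := hk
    simp [this, this.le]
  · simp [h]
  · have : (j : ℕ) < k := hk
    simp [this.not_ge, this.not_gt]

lemma topCards_pairwise {n : ℕ} (ω : Fin n → Bool) (j : ℕ) :
    (topCards ω j).Pairwise (· < ·) := by
  unfold topCards
  rw [List.pairwise_map]
  refine ((List.pairwise_lt_finRange n).filter _).imp fun {a b} h => ?_
  have : (a : ℕ) < b := h
  omega

lemma filter_eq_of_finRange_split {n : ℕ} (ω : Fin n → Bool) {i : Fin n} {l₁ l₂ : List (Fin n)}
    (h : List.finRange n = l₁ ++ i :: l₂) (h₁ : ∀ k, k ∈ l₁ ↔ k < i) (h₂ : ∀ k, k ∈ l₂ ↔ i < k) :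
    (l₁.filter fun k => ω k).map (fun k : Fin n => (k : ℕ) + 1) = topCards ω i := by
  unfold topCards
  rw [h, List.filter_append]
  have : ((i :: l₂).filter fun k : Fin n => decide ((k : ℕ) < i) && ω k) = [] := by
    rw [List.filter_eq_nil_iff]
    intro k hk
    rcases List.mem_cons.1 hk with rfl | hk
    · simp
    · have : (i : ℕ) < k := (h₂ k).1 hk
      simp [this.not_gt]
  rw [this, List.append_nil]
  congr 1
  refine List.filter_congr fun k hk => ?_
  have : (k : ℕ) < i := (h₁ k).1 hk
  simp [this]

lemma shelfDeck_eq_of_finRange_split {n : ℕ} (ω : Fin n → Bool) {i : Fin n}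
    {l₁ l₂ : List (Fin n)} (h : List.finRange n = l₁ ++ i :: l₂) (h₁ : ∀ k, k ∈ l₁ ↔ k < i)
    (h₂ : ∀ k, k ∈ l₂ ↔ i < k) :
    shelfDeck n ω = topCards ω i ++ (shelfPile ω [] (i :: l₂) ++
      ((l₁.filter fun k => !ω k).map (fun k : Fin n => (k : ℕ) + 1)).reverse) := by
  rw [shelfDeck_eq_shelfPile, h, shelfPile_append, shelfPile_eq _ _ l₁,
    filter_eq_of_finRange_split ω h h₁ h₂]

/-- A card that was put on top is preceded exactly by the smaller cards that were put on top. -/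
lemma shelfDeck_eq_of_true {n : ℕ} (ω : Fin n → Bool) (i : Fin n) (hi : ω i = true) :
    ∃ s, shelfDeck n ω = topCards ω i ++ ((i : ℕ) + 1) :: s := by
  obtain ⟨l₁, l₂, h, h₁, h₂⟩ := exists_finRange_split i
  rw [shelfDeck_eq_of_finRange_split ω h h₁ h₂]
  have : shelfPile ω [] (i :: l₂) = ((i : ℕ) + 1) :: shelfPile ω [] l₂ := by
    simp [shelfPile, hi]
  exact ⟨_, by rw [this, List.cons_append]⟩

/-- A card that was put at the bottom is preceded by all larger cards. -/
lemma shelfDeck_eq_of_false {n : ℕ} (ω : Fin n → Bool) (i : Fin n) (hi : ω i = false) :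
    ∃ p s, shelfDeck n ω = p ++ ((i : ℕ) + 1) :: s ∧ ∀ k, i < k → (k : ℕ) + 1 ∈ p := by
  obtain ⟨l₁, l₂, h, h₁, h₂⟩ := exists_finRange_split i
  rw [shelfDeck_eq_of_finRange_split ω h h₁ h₂]
  have : shelfPile ω [] (i :: l₂) = shelfPile ω [] l₂ ++ [(i : ℕ) + 1] := by
    simp [shelfPile, hi]
  refine ⟨topCards ω i ++ shelfPile ω [] l₂, _, by rw [this]; simp; rfl, fun k hk => ?_⟩
  rw [List.mem_append, (shelfPile_perm ω l₂).mem_iff]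
  exact Or.inr (List.mem_map.2 ⟨k, (h₂ k).2 hk, rfl⟩)

/-- The deck rises up to the largest card; the cards after it depend only on the cards before it. -/
lemma shelfDeck_succ_eq {m : ℕ} (ω : Fin (m + 1) → Bool) :
    shelfDeck (m + 1) ω = topCards ω m ++ (m + 1) ::
      (((List.finRange (m + 1)).filter fun k : Fin (m + 1) => decide ((k : ℕ) < m) && !ω k).map
        (fun k : Fin (m + 1) => (k : ℕ) + 1)).reverse := by
  obtain ⟨l₁, l₂, h, h₁, h₂⟩ := exists_finRange_split (Fin.last m)
  have hl₂ : l₂ = [] := by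
    rw [List.eq_nil_iff_forall_not_mem]
    exact fun k hk => absurd ((h₂ k).1 hk) (not_lt.2 (Fin.le_last k))
  rw [shelfDeck_eq_of_finRange_split ω h h₁ h₂, hl₂]
  have h3 := filter_eq_of_finRange_split (fun k => !ω k) h h₁ h₂
  have : shelfPile ω [] [Fin.last m] = [m + 1] := by simp [shelfPile]
  rw [this, h3]
  rfl

/-! ### What a history reveals about the coins -/

lemma topCards_prefix_of_prefix {m : ℕ} {ω : Fin (m + 1) → Bool} {p : List ℕ}
    (h : p <+: shelfDeck (m + 1) ω) (hp : m + 1 ∉ p) : p <+: topCards ω m := by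
  rw [shelfDeck_succ_eq] at h
  obtain ⟨t, ht⟩ := h
  rcases List.append_eq_append_iff.1 ht with ⟨a, ha, -⟩ | ⟨a, ha, hb⟩
  · exact ⟨a, ha.symm⟩
  · cases a with
    | nil => simp [ha]
    | cons x a =>
      simp only [List.cons_append, List.cons.injEq] at hb
      exact absurd (by rw [ha, ← hb.1]; simp) hp

/-- The cards before the largest one determine every coin except that of the largest card, which is
placed on an empty pile and so has no effect. -/
lemma eq_of_prefix_of_max_mem {m : ℕ} {ω ω' : Fin (m + 1) → Bool} {p s : List ℕ} {c d : ℕ}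
    (h : shelfDeck (m + 1) ω = p ++ d :: s) (hp : m + 1 ∈ p)
    (h' : p ++ [c] <+: shelfDeck (m + 1) ω') : c = d := by
  have hn (ω : Fin (m + 1) → Bool) : m + 1 ∉ topCards ω m := by
    rw [mem_topCards]
    rintro ⟨k, hk, -, hk'⟩
    omega
  obtain ⟨t, ht⟩ := h'
  obtain ⟨a, b, rfl⟩ := List.append_of_mem hp
  have e1 := h
  have e2 := ht
  rw [shelfDeck_succ_eq] at e1 e2
  have hD (ω : Fin (m + 1) → Bool) : m + 1 ∉ (((List.finRange (m + 1)).filter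
      fun k : Fin (m + 1) => decide ((k : ℕ) < m) && !ω k).map
        fun k : Fin (m + 1) => (k : ℕ) + 1).reverse := by
    simp only [List.mem_reverse, List.mem_map, List.mem_filter]
    rintro ⟨k, ⟨-, hk⟩, hk'⟩
    simp only [Bool.and_eq_true, decide_eq_true_eq] at hk
    omega
  simp only [List.append_assoc, List.cons_append] at e1 e2
  have f1 := (List.append_cons_inj_of_notMem (hn ω) (hD ω)).1 e1
  have f2 := (List.append_cons_inj_of_notMem (hn ω') (hD ω')).1 e2.symm
  have key : ∀ k : Fin (m + 1), (k : ℕ) < m → ω k = ω' k := by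
    intro k hk
    have hmem (ω : Fin (m + 1) → Bool) : (k : ℕ) + 1 ∈ topCards ω m ↔ ω k = true := by
      rw [mem_topCards]
      constructor
      · rintro ⟨k', -, h, e⟩
        rwa [← Fin.ext (Nat.succ_injective e)]
      · exact fun h => ⟨k, hk, h, rfl⟩
    rw [Bool.eq_iff_iff, ← hmem, ← hmem, f1.1, f2.1]
  have : shelfDeck (m + 1) ω = shelfDeck (m + 1) ω' := by
    rw [shelfDeck_succ_eq, shelfDeck_succ_eq, topCards_congr key]
    congr 4
    refine List.filter_congr fun k _ => ?_
    by_cases hk : (k : ℕ) < m <;> simp [hk, key]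
  rw [h, ← ht] at this
  simp only [List.append_assoc, List.append_cancel_left_eq, List.cons_append, List.nil_append,
    List.cons.injEq, true_and] at this
  exact this.1.symm

/-- Seeing only the cards of `topCards ω j` reveals the first `j` coins. -/
lemma eq_of_topCards_prefix {m j : ℕ} (hj : j ≤ m) {ω ω' : Fin (m + 1) → Bool}
    (hprev : ∀ k : Fin (m + 1), (k : ℕ) + 1 = j → ω k = true)
    (h : topCards ω j <+: shelfDeck (m + 1) ω') (k : Fin (m + 1)) (hk : (k : ℕ) < j) :
    ω' k = ω k := by
  have h1 : topCards ω j <+: topCards ω' m := by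
    refine topCards_prefix_of_prefix h ?_
    rw [mem_topCards]
    rintro ⟨k, hk, -, hk'⟩
    omega
  rw [Bool.eq_iff_iff]
  constructor
  · intro hk'
    obtain ⟨q, hq⟩ := h1
    have hs := topCards_pairwise ω' m
    rw [← hq, List.pairwise_append] at hs
    have hmem : (k : ℕ) + 1 ∈ topCards ω' m := (mem_topCards _ _ _).2 ⟨k, by omega, hk', rfl⟩
    rw [← hq, List.mem_append] at hmem
    rcases hmem with hmem | hmem
    · obtain ⟨k', -, h, e⟩ := (mem_topCards _ _ _).1 hmem
      rwa [← Fin.ext (Nat.succ_injective e)]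
    -- Card `j` itself has been shown by `hprev`, so every later card of the rising part exceeds `j`
    -- and cannot be `k + 1`.
    · have hjm : j ∈ topCards ω j := (mem_topCards _ _ _).2
        ⟨⟨j - 1, by omega⟩, by simp; omega, hprev _ (by simp; omega), by simp; omega⟩
      have := hs.2.2 _ hjm _ hmem
      omega
  · intro hk'
    have hmem : (k : ℕ) + 1 ∈ topCards ω j := (mem_topCards _ _ _).2 ⟨k, hk, hk', rfl⟩
    obtain ⟨k', -, h, e⟩ := (mem_topCards _ _ _).1 (h1.subset hmem)
    rwa [← Fin.ext (Nat.succ_injective e)]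

/-! ### Optimality at a single history -/

lemma integral_coinMeasure {E : Type*} [NormedAddCommGroup E] [NormedSpace ℝ E] [CompleteSpace E]
    (n : ℕ) (f : (Fin n → Bool) → E) :
    ∫ ω, f ω ∂coinMeasure n = ((2 : ℝ) ^ n)⁻¹ • ∑ ω, f ω := by
  rw [coinMeasure, PMF.integral_eq_sum, Finset.smul_sum]
  simp

lemma getElem?_eq_some_take_iff (deck h : List ℕ) (c : ℕ) :
    (deck[h.length]? = some c ∧ deck.take h.length = h) ↔ h ++ [c] <+: deck := by
  constructor
  · rintro ⟨h1, h2⟩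
    rw [List.prefix_iff_eq_take]
    simp [List.take_add_one, h1, h2]
  · rintro ⟨t, rfl⟩
    simp

/-- Changing a strategy at the single history `h` only affects the guess made after `h`. -/
lemma correctGuesses_update (g : Strategy) (h : List ℕ) (c : ℕ) (deck : List ℕ) :
    correctGuesses (Function.update g h c) deck + (if h ++ [g h] <+: deck then 1 else 0) =
      correctGuesses g deck + (if h ++ [c] <+: deck then 1 else 0) := by
  unfold correctGuesses
  simp only [Finset.card_filter]
  by_cases hk : h.length < deck.length
  · have hmem : h.length ∈ Finset.range deck.length := Finset.mem_range.2 hk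
    rw [← Finset.add_sum_erase _ _ hmem, ← Finset.add_sum_erase _ _ hmem]
    have hrest : ∀ k ∈ (Finset.range deck.length).erase h.length,
        (if deck[k]? = some (Function.update g h c (deck.take k)) then 1 else 0) =
          if deck[k]? = some (g (deck.take k)) then 1 else 0 := by
      intro k hk'
      rw [Finset.mem_erase, Finset.mem_range] at hk'
      rw [Function.update_of_ne]
      intro e
      have := congrArg List.length e
      rw [List.length_take] at this
      omega
    rw [Finset.sum_congr rfl hrest]
    simp only [← getElem?_eq_some_take_iff]
    by_cases ht : deck.take h.length = h
    · simp only [ht, Function.update_self, and_true]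
      omega
    · simp [ht]
  · have hp (d : ℕ) : ¬ h ++ [d] <+: deck := fun hd => by
      have := hd.length_le
      simp at this
      omega
    simp only [hp, if_false, add_zero]
    refine Finset.sum_congr rfl fun k hk' => ?_
    rw [Finset.mem_range] at hk'
    rw [Function.update_of_ne]
    intro e
    have := congrArg List.length e
    rw [List.length_take] at this
    omega

/-- Global optimality implies local optimality: otherwise changing the guess after `h` alone would
raise the expectation. -/
lemma isOptimal_card_le {n : ℕ} {g : Strategy} (hg : IsOptimal n g) (h : List ℕ) (c : ℕ) :
    (Finset.univ.filter fun ω : Fin n → Bool => h ++ [c] <+: shelfDeck n ω).card ≤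
      (Finset.univ.filter fun ω : Fin n → Bool => h ++ [g h] <+: shelfDeck n ω).card := by
  have h1 := hg (Function.update g h c)
  rw [integral_coinMeasure, integral_coinMeasure] at h1
  have h2 : ∑ ω, (numCorrect n (Function.update g h c) ω : ℝ) ≤ ∑ ω, (numCorrect n g ω : ℝ) :=
    le_of_smul_le_smul_left h1 (by positivity)
  norm_cast at h2
  have h3 := Finset.sum_congr (rfl : (Finset.univ : Finset (Fin n → Bool)) = _)
    fun ω _ => correctGuesses_update g h c (shelfDeck n ω)
  rw [Finset.sum_add_distrib, Finset.sum_add_distrib, ← Finset.card_filter,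
    ← Finset.card_filter] at h3
  unfold numCorrect at h2
  omega

/-- If the history reveals the next card then an optimal strategy guesses it. -/
lemma isOptimal_eq_of_forall_prefix {n : ℕ} {g : Strategy} (hg : IsOptimal n g) {h : List ℕ} {d : ℕ}
    {ω : Fin n → Bool} (hω : h ++ [d] <+: shelfDeck n ω)
    (hd : ∀ (ω' : Fin n → Bool) (c : ℕ), h ++ [c] <+: shelfDeck n ω' → c = d) : g h = d := by
  have h1 := isOptimal_card_le hg h d
  have h2 : 0 < (Finset.univ.filter fun ω : Fin n → Bool => h ++ [d] <+: shelfDeck n ω).card :=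
    Finset.card_pos.2 ⟨ω, by simpa using hω⟩
  obtain ⟨ω', hω'⟩ := Finset.card_pos.1 (h2.trans_le h1)
  exact hd ω' _ (by simpa using hω')

/-! ### Optimal guesses in the rising part -/

lemma topCards_append_succ_prefix {n : ℕ} {ω ω' : Fin n → Bool} (i : Fin n)
    (h : ∀ k : Fin n, k < i → ω' k = ω k) (hi : ω' i = true) :
    topCards ω i ++ [(i : ℕ) + 1] <+: shelfDeck n ω' := by
  obtain ⟨s, hs⟩ := shelfDeck_eq_of_true ω' i hi
  rw [hs, topCards_congr (ω := ω) (ω' := ω') fun k hk => (h k hk).symm]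
  exact ⟨s, by simp⟩

lemma eq_of_append_prefix {deck p s : List ℕ} {c d : ℕ} (h : deck = p ++ d :: s)
    (h' : p ++ [c] <+: deck) : c = d := by
  obtain ⟨t, rfl⟩ := h'
  simp only [List.append_assoc, List.append_cancel_left_eq, List.cons_append, List.nil_append,
    List.cons.injEq] at h
  exact h.1

/-- For every guess `c` other than `j + 1` there is an arrangement that agrees with `ω` before `j`,
has card `j + 1` at the bottom, and whose next card after `topCards ω j` is not `c`. -/
lemma exists_not_topCards_append_prefix {n j : ℕ} (hj : j + 3 ≤ n) (ω : Fin n → Bool) (c : ℕ) :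
    ∃ ω' : Fin n → Bool, (∀ k : Fin n, (k : ℕ) < j → ω' k = ω k) ∧
      ω' ⟨j, by omega⟩ = false ∧ ¬ topCards ω j ++ [c] <+: shelfDeck n ω' := by
  -- The next card is made `j + 3` if `c = j + 2`, and `j + 2` otherwise. With only two cards above
  -- `j` the first option is missing, and the guesses `j + 1` and `j + 2` tie.
  let ω' : Fin n → Bool := fun k => if (k : ℕ) < j then ω k else if (k : ℕ) = j then false
    else if (k : ℕ) = j + 1 then decide (c ≠ j + 2) else true
  have hlt (k : Fin n) (hk : (k : ℕ) < j) : ω' k = ω k := by simp [ω', hk]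
  have hjf : ω' ⟨j, by omega⟩ = false := by simp [ω']
  refine ⟨ω', hlt, hjf, fun hpre => ?_⟩
  have ht : topCards ω' (j + 1) = topCards ω j := by
    rw [topCards_succ_of_false ⟨j, by omega⟩ hjf]
    exact topCards_congr hlt
  by_cases hc : c = j + 2
  · have hj1 : ω' ⟨j + 1, by omega⟩ = false := by simp [ω', hc]
    have ht2 : topCards ω' (j + 2) = topCards ω j := by
      rw [← ht]
      exact topCards_succ_of_false ⟨j + 1, by omega⟩ hj1
    obtain ⟨s, hs⟩ := shelfDeck_eq_of_true ω' ⟨j + 2, by omega⟩ (by simp [ω'])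
    simp only [ht2] at hs
    have := eq_of_append_prefix hs hpre
    omega
  · obtain ⟨s, hs⟩ := shelfDeck_eq_of_true ω' ⟨j + 1, by omega⟩ (by simp [ω', hc])
    simp only [ht] at hs
    have := eq_of_append_prefix hs hpre
    omega

/-- While the deck rises and at least three cards above the last shown card `j` remain, an optimal
strategy guesses `j + 1`. -/
lemma isOptimal_topCards {n j : ℕ} {g : Strategy} (hg : IsOptimal n g) (hj : j + 3 ≤ n)
    (ω : Fin n → Bool) (hprev : ∀ k : Fin n, (k : ℕ) + 1 = j → ω k = true) :
    g (topCards ω j) = j + 1 := by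
  obtain ⟨m, rfl⟩ : ∃ m, n = m + 1 := ⟨n - 1, by omega⟩
  by_contra hne
  have hle := isOptimal_card_le hg (topCards ω j) (j + 1)
  set c := g (topCards ω j) with hc
  obtain ⟨ω₀, h0, h0j, h0c⟩ := exists_not_topCards_append_prefix hj ω c
  set i : Fin (m + 1) := ⟨j, by omega⟩ with hi
  have key : ∀ ω' : Fin (m + 1) → Bool, topCards ω j ++ [c] <+: shelfDeck (m + 1) ω' →
      (∀ k : Fin (m + 1), k < i → ω' k = ω k) ∧ ω' i = false := by
    intro ω' h'
    have hag : ∀ k : Fin (m + 1), k < i → ω' k = ω k := fun k hk =>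
      eq_of_topCards_prefix (by omega) hprev ((List.prefix_append _ _).trans h') k hk
    refine ⟨hag, ?_⟩
    by_contra ht
    obtain ⟨s, hs⟩ := shelfDeck_eq_of_true ω' i (by simpa using ht)
    rw [topCards_congr (ω := ω') (ω' := ω) hag] at hs
    exact hne (eq_of_append_prefix hs h')
  -- Turning coin `i` to `true` injects the arrangements showing `c` next into those showing `j + 1`
  -- next; the image misses the one obtained from `ω₀`, so the inequality is strict.
  refine absurd hle (not_le.2 ?_)
  rw [← Finset.card_image_of_injOn (f := fun ω' => Function.update ω' i true)]
  · refine Finset.card_lt_card (Finset.ssubset_iff_of_subset ?_ |>.2 ?_)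
    · intro ω'' h''
      obtain ⟨ω', h', rfl⟩ := Finset.mem_image.1 h''
      rw [Finset.mem_filter] at h' ⊢
      refine ⟨Finset.mem_univ _, topCards_append_succ_prefix i (fun k hk => ?_) (by simp)⟩
      rw [Function.update_of_ne hk.ne]
      exact (key ω' h'.2).1 k hk
    · refine ⟨Function.update ω₀ i true, ?_, ?_⟩
      · rw [Finset.mem_filter]
        refine ⟨Finset.mem_univ _, topCards_append_succ_prefix i (fun k hk => ?_) (by simp)⟩
        rw [Function.update_of_ne hk.ne]
        exact h0 k hk
      · intro hmem
        obtain ⟨ω', h', he⟩ := Finset.mem_image.1 hmem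
        rw [Finset.mem_filter] at h'
        have : ω' = ω₀ := by
          funext k
          by_cases hk : k = i
          · rw [hk, (key ω' h'.2).2, h0j]
          · simpa [hk] using congrFun he k
        exact h0c (this ▸ h'.2)
  · intro ω' h' ω'' h'' he
    simp only [Finset.coe_filter, Finset.mem_univ, true_and, Set.mem_ofPred_eq] at h' h''
    funext k
    by_cases hk : k = i
    · rw [hk, (key ω' h').2, (key ω'' h'').2]
    · simpa [hk] using congrFun he k

/-- The coin of the card just above card `i + 1`, with the convention `true` for the first card. -/
def prevCoin {n : ℕ} (ω : Fin n → Bool) (i : Fin n) : Bool :=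
  (Fin.cons true ω : Fin (n + 1) → Bool) i.castSucc

/-- Bottom cards leave no trace in the rising part, so one can go back to the last top card, where
`isOptimal_topCards` gives the guess. -/
lemma exists_topCards_eq {n : ℕ} (ω : Fin n → Bool) (j : ℕ) (hj : j ≤ n) :
    ∃ j' ≤ j, topCards ω j' = topCards ω j ∧ ∀ k : Fin n, (k : ℕ) + 1 = j' → ω k = true := by
  induction j with
  | zero => exact ⟨0, le_rfl, rfl, fun k hk => by omega⟩
  | succ j ih =>
    cases h : ω ⟨j, by omega⟩ with
    | true =>
      refine ⟨j + 1, le_rfl, rfl, fun k hk => ?_⟩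
      rw [← h]
      congr 1
      exact Fin.ext (by simpa using hk)
    | false =>
      obtain ⟨j', h1, h2, h3⟩ := ih (by omega)
      exact ⟨j', by omega, h2.trans (topCards_succ_of_false ⟨j, by omega⟩ h).symm, h3⟩

/-- A card that was put on top is guessed if and only if the preceding card was put on top. -/
lemma isOptimal_topCards_iff {n : ℕ} {g : Strategy} (hg : IsOptimal n g) (ω : Fin n → Bool)
    (i : Fin n) (hi : (i : ℕ) + 3 ≤ n) :
    g (topCards ω i) = (i : ℕ) + 1 ↔ prevCoin ω i = true := by
  obtain ⟨i, hin⟩ := i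
  cases i with
  | zero =>
    have : prevCoin ω ⟨0, hin⟩ = true := rfl
    simp only [this, iff_true]
    exact isOptimal_topCards hg hi ω fun k hk => by simp at hk
  | succ i =>
    have hp : prevCoin ω ⟨i + 1, hin⟩ = ω ⟨i, by omega⟩ := rfl
    rw [hp]
    constructor
    · intro h
      by_contra hf
      obtain ⟨j', h1, h2, h3⟩ := exists_topCards_eq ω i (by omega)
      have h4 := isOptimal_topCards hg (j := j') (by simp at hi; omega) ω h3
      have h5 := topCards_succ_of_false (ω := ω) ⟨i, by omega⟩ (by simpa using hf)
      simp only [h5, ← h2, h4] at h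
      omega
    · intro h
      refine isOptimal_topCards hg hi ω fun k hk => ?_
      rw [← h]
      congr 1
      exact Fin.ext (by simpa using hk)

/-! ### Counting correct guesses by card -/

/-- The strategy `g` guesses the card `c` of the deck correctly. -/
def IsGuessed (g : Strategy) (deck : List ℕ) (c : ℕ) : Prop :=
  ∃ p s, deck = p ++ c :: s ∧ g p = c

lemma isGuessed_iff {g : Strategy} {deck p s : List ℕ} {c : ℕ} (hd : deck.Nodup)
    (h : deck = p ++ c :: s) : IsGuessed g deck c ↔ g p = c := by
  refine ⟨?_, fun hp => ⟨p, s, h, hp⟩⟩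
  rintro ⟨p', s', h', hp'⟩
  have hn : c ∉ p ∧ c ∉ s := by
    rw [h, List.nodup_middle, List.nodup_cons] at hd
    simpa using hd.1
  rw [h] at h'
  rwa [((List.append_cons_inj_of_notMem hn.1 hn.2).1 h').1]

open Classical in
lemma numCorrect_eq_card {n : ℕ} (g : Strategy) (ω : Fin n → Bool) :
    numCorrect n g ω =
      (Finset.univ.filter fun i : Fin n => IsGuessed g (shelfDeck n ω) ((i : ℕ) + 1)).card := by
  unfold numCorrect correctGuesses
  set deck := shelfDeck n ω with hdeck
  have hmem : ∀ i : Fin n, (i : ℕ) + 1 ∈ deck := fun i => (mem_shelfDeck ω _).2 ⟨i, rfl⟩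
  symm
  -- Cards correspond to their positions, as the deck has no repetitions.
  refine Finset.card_bij (fun i _ => deck.idxOf ((i : ℕ) + 1)) ?_ ?_ ?_
  · intro i hi
    obtain ⟨p, s, h, hp⟩ := (Finset.mem_filter.1 hi).2
    have hd := shelfDeck_nodup n ω
    rw [← hdeck, h, List.nodup_middle, List.nodup_cons] at hd
    have hn : (i : ℕ) + 1 ∉ p := fun h' => hd.1 (by simp [h'])
    have hidx : deck.idxOf ((i : ℕ) + 1) = p.length := by
      rw [h, List.idxOf_append_of_notMem hn]
      simp
    rw [Finset.mem_filter, Finset.mem_range, hidx, h]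
    simp [hp]
  · intro i _ j _ h
    have := (List.idxOf_inj (hmem i)).1 h
    exact Fin.ext (by omega)
  · intro k hk
    rw [Finset.mem_filter, Finset.mem_range] at hk
    obtain ⟨i, hi⟩ := (mem_shelfDeck ω _).1 (List.getElem_mem (l := deck) hk.1)
    have hs : deck = deck.take k ++ ((i : ℕ) + 1) :: deck.drop (k + 1) := by
      rw [hi, List.getElem_cons_drop, List.take_append_drop]
    refine ⟨i, Finset.mem_filter.2 ⟨Finset.mem_univ _, _, _, hs, ?_⟩, ?_⟩
    · have := hk.2
      rw [List.getElem?_eq_getElem hk.1, Option.some.injEq] at this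
      rw [← this, hi]
    · rw [hi]
      exact (shelfDeck_nodup n ω).idxOf_getElem k hk.1

/-- Apart from the two largest cards, an optimal strategy misses exactly the cards put on top whose
predecessor was put at the bottom. -/
lemma isGuessed_iff_of_isOptimal {n : ℕ} {g : Strategy} (hg : IsOptimal n g) (ω : Fin n → Bool)
    (i : Fin n) (hi : (i : ℕ) + 3 ≤ n) :
    IsGuessed g (shelfDeck n ω) ((i : ℕ) + 1) ↔ ¬ (ω i = true ∧ prevCoin ω i = false) := by
  cases h : ω i with
  | true =>
    obtain ⟨s, hs⟩ := shelfDeck_eq_of_true ω i h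
    rw [isGuessed_iff (shelfDeck_nodup n ω) hs, isOptimal_topCards_iff hg ω i hi]
    simp
  | false =>
    obtain ⟨m, rfl⟩ : ∃ m, n = m + 1 := ⟨n - 1, by omega⟩
    obtain ⟨p, s, hs, hp⟩ := shelfDeck_eq_of_false ω i h
    rw [isGuessed_iff (shelfDeck_nodup _ ω) hs]
    simp only [Bool.false_eq_true, false_and, not_false_eq_true, iff_true]
    have hlast : m + 1 ∈ p := hp (Fin.last m) (Fin.lt_def.2 (by simp; omega))
    refine isOptimal_eq_of_forall_prefix hg (ω := ω) ⟨s, by rw [hs]; simp⟩ fun ω' c hc => ?_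
    exact eq_of_prefix_of_max_mem hs hlast hc

/-! ### Misses and coin changes -/

/-- Whether the coin differs from the preceding one. -/
def coinChanges {n : ℕ} (ω : Fin n → Bool) (i : Fin n) : Bool := xor (ω i) (prevCoin ω i)

/-- The changes and the initial value `true` recover the coins one by one; hence the changes are
uniformly distributed too. -/
lemma coinChanges_bijective (n : ℕ) :
    Function.Bijective (coinChanges : (Fin n → Bool) → Fin n → Bool) := by
  refine Finite.injective_iff_bijective.1 fun ω ω' h => ?_
  have key : ∀ k : Fin (n + 1), (Fin.cons true ω : Fin (n + 1) → Bool) k =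
      (Fin.cons true ω' : Fin (n + 1) → Bool) k := by
    intro k
    induction k using Fin.induction with
    | zero => rfl
    | succ i ih =>
      have hi := congrFun h i
      simp only [coinChanges, prevCoin, ih] at hi
      simpa using hi
  funext i
  simpa using key i.succ

/-- Ascents and descents alternate, and since the sequence starts at `true` the first change is a
descent. -/
lemma card_ascents_le {n : ℕ} (ω : Fin n → Bool) :
    let A := (Finset.univ.filter fun i => ω i = true ∧ prevCoin ω i = false).card
    let C := (Finset.univ.filter fun i => coinChanges ω i = true).card
    2 * A ≤ C ∧ C ≤ 2 * A + 1 := by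
  intro A C
  let f : Fin (n + 1) → ℤ := fun k => if (Fin.cons true ω : Fin (n + 1) → Bool) k then 1 else 0
  -- At each index, change = 2 · ascent + previous value − current value; the last two terms
  -- telescope.
  have h1 : (C : ℤ) = 2 * A + ∑ i : Fin n, f i.castSucc - ∑ i : Fin n, f i.succ := by
    simp only [A, C, Finset.card_filter]
    push_cast
    rw [Finset.mul_sum, ← Finset.sum_add_distrib, ← Finset.sum_sub_distrib]
    refine Finset.sum_congr rfl fun i _ => ?_
    have e1 : f i.castSucc = if prevCoin ω i then 1 else 0 := rfl
    have e2 : f i.succ = if ω i then 1 else 0 := by simp [f]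
    rw [e1, e2, coinChanges]
    cases ω i <;> cases prevCoin ω i <;> simp
  have h2 := (Fin.sum_univ_succ f).symm.trans (Fin.sum_univ_castSucc f)
  have h3 : f 0 = 1 := rfl
  have h4 : f (Fin.last n) = 1 ∨ f (Fin.last n) = 0 := by
    simp only [f]
    split <;> simp
  omega

lemma numCorrect_of_isOptimal {n : ℕ} {g : Strategy} (hg : IsOptimal n g) (ω : Fin n → Bool) :
    let A := (Finset.univ.filter fun i => ω i = true ∧ prevCoin ω i = false).card
    n ≤ numCorrect n g ω + A + 2 ∧ numCorrect n g ω + A ≤ n + 2 := by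
  classical
  intro A
  set S := Finset.univ.filter fun i : Fin n => IsGuessed g (shelfDeck n ω) ((i : ℕ) + 1) with hS
  set T := Finset.univ.filter fun i : Fin n => ω i = true ∧ prevCoin ω i = false with hT
  set R := Finset.univ.filter fun i : Fin n => n < (i : ℕ) + 3 with hR
  have hRc : R.card ≤ 2 := by
    have : R.card ≤ (Finset.Ico (n - 2) n).card := by
      refine Finset.card_le_card_of_injOn (fun i => (i : ℕ)) (fun i hi => ?_)
        (fun i _ j _ h => Fin.ext h)
      have : n < (i : ℕ) + 3 := by simpa [hR] using hi
      simp only [Finset.coe_Ico, Set.mem_Ico]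
      omega
    rw [Nat.card_Ico] at this
    omega
  have hiff : ∀ i, i ∉ R → (i ∈ S ↔ i ∉ T) := by
    intro i hi
    simp only [hR, Finset.mem_filter, Finset.mem_univ, true_and, not_lt] at hi
    simpa [hS, hT] using isGuessed_iff_of_isOptimal hg ω i hi
  have e0 : A = T.card := rfl
  have e1 : numCorrect n g ω = S.card := numCorrect_eq_card g ω
  have e2 : T.card + Tᶜ.card = n := by simp
  have e3 : S.card ≤ Tᶜ.card + R.card :=
    (Finset.card_le_card fun i hi => by
      by_cases h : i ∈ R
      · simp [h]
      · simpa [h] using (hiff i h).1 hi).trans (Finset.card_union_le _ _)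
  have e4 : Tᶜ.card ≤ S.card + R.card :=
    (Finset.card_le_card fun i hi => by
      by_cases h : i ∈ R
      · simp [h]
      · simpa [h] using (hiff i h).2 (by simpa using hi)).trans (Finset.card_union_le _ _)
  omega

/-- The fair sign attached to a coin. -/
def coinSign (b : Bool) : ℝ := if b then -1 else 1

/-- The constant is `10 = 4 * 2 + 2`: the two largest cards cost at most 2 in the count, which is
scaled by 4, and `2 * C` exceeds `4 * A` by at most 2. -/
lemma abs_normalized_numCorrect_sub_le {n : ℕ} {g : Strategy} (hg : IsOptimal n g)
    (ω : Fin n → Bool) :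
    |((numCorrect n g ω : ℝ) - 3 / 4 * (n : ℝ)) / (Real.sqrt n / 4) -
      (Real.sqrt n)⁻¹ * ∑ i, coinSign (coinChanges ω i)| ≤ 10 * (Real.sqrt n)⁻¹ := by
  obtain ⟨h1, h2⟩ := numCorrect_of_isOptimal hg ω
  obtain ⟨h3, h4⟩ := card_ascents_le ω
  set A := (Finset.univ.filter fun i => ω i = true ∧ prevCoin ω i = false).card
  set C := (Finset.univ.filter fun i => coinChanges ω i = true).card with hC
  have hsum : ∑ i, coinSign (coinChanges ω i) = n - 2 * C := by
    have : ∀ i, coinSign (coinChanges ω i) = 1 - 2 * if coinChanges ω i = true then 1 else 0 := by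
      intro i
      unfold coinSign
      split <;> norm_num
    simp only [this, Finset.sum_sub_distrib, ← Finset.mul_sum, hC, Finset.card_filter]
    simp
  rw [hsum]
  have e : ((numCorrect n g ω : ℝ) - 3 / 4 * (n : ℝ)) / (Real.sqrt n / 4) -
      (Real.sqrt n)⁻¹ * (n - 2 * C) = (4 * numCorrect n g ω - 4 * n + 2 * C) * (Real.sqrt n)⁻¹ := by
    rw [div_div_eq_mul_div, div_eq_mul_inv]
    ring
  rw [e, abs_mul, abs_of_nonneg (inv_nonneg.2 (Real.sqrt_nonneg n))]
  refine mul_le_mul_of_nonneg_right ?_ (inv_nonneg.2 (Real.sqrt_nonneg n))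
  have r1 : (n : ℝ) ≤ numCorrect n g ω + A + 2 := by exact_mod_cast h1
  have r2 : (numCorrect n g ω : ℝ) + A ≤ n + 2 := by exact_mod_cast h2
  have r3 : (2 : ℝ) * A ≤ C := by exact_mod_cast h3
  have r4 : (C : ℝ) ≤ 2 * A + 1 := by exact_mod_cast h4
  rw [abs_le]
  constructor <;> linarith

/-! ### Characteristic functions and the limit -/

lemma integral_uniform_bool {E : Type*} [NormedAddCommGroup E] [NormedSpace ℝ E] [CompleteSpace E]
    (f : Bool → E) :
    ∫ b, f b ∂(PMF.uniformOfFintype Bool).toMeasure = (2 : ℝ)⁻¹ • ∑ b, f b := by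
  rw [PMF.integral_eq_sum, Finset.smul_sum]
  simp

/-- The characteristic function of the normalized sum of the signs of the coin changes. -/
lemma integral_exp_sum_coinSign (n : ℕ) (t : ℝ) :
    ∫ ω, Complex.exp (t * ((Real.sqrt n)⁻¹ * ∑ i, coinSign (coinChanges ω i) : ℝ) * Complex.I)
        ∂coinMeasure n =
      charFun ((PMF.uniformOfFintype Bool).toMeasure.map coinSign) ((Real.sqrt n)⁻¹ * t) ^ n := by
  -- The bijection replaces the changes by the coins themselves; `Fintype.sum_pow` then expands the
  -- power into a sum over all coin sequences.
  rw [integral_coinMeasure, (coinChanges_bijective n).sum_comp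
    (fun ω => Complex.exp (t * ((Real.sqrt n)⁻¹ * ∑ i, coinSign (ω i) : ℝ) * Complex.I)),
    charFun_apply_real, integral_map (by fun_prop) (by fun_prop), integral_uniform_bool,
    smul_pow, inv_pow, Fintype.sum_pow]
  congr 1
  refine Finset.sum_congr rfl fun ω _ => ?_
  rw [← Complex.exp_sum]
  congr 1
  push_cast
  rw [Finset.mul_sum, Finset.mul_sum, Finset.sum_mul]
  exact Finset.sum_congr rfl fun i _ => by ring

lemma norm_exp_mul_I_sub_exp_mul_I_le (x y : ℝ) :
    ‖Complex.exp (x * Complex.I) - Complex.exp (y * Complex.I)‖ ≤ |x - y| := by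
  have : Complex.exp (x * Complex.I) - Complex.exp (y * Complex.I) =
      Complex.exp (y * Complex.I) * (Complex.exp (Complex.I * (x - y : ℝ)) - 1) := by
    rw [mul_sub, ← Complex.exp_add, mul_one]
    push_cast
    ring_nf
  rw [this, norm_mul, Complex.norm_exp_ofReal_mul_I, one_mul]
  exact Real.norm_exp_I_mul_ofReal_sub_one_le

/-- Sequences of random variables at uniformly vanishing distance have the same limit of
characteristic functions. -/
lemma tendsto_integral_exp_of_abs_sub_le {Ω : ℕ → Type*} [∀ n, MeasurableSpace (Ω n)]
    {μ : ∀ n, Measure (Ω n)} [∀ n, IsProbabilityMeasure (μ n)] {X Y : ∀ n, Ω n → ℝ} {ε : ℕ → ℝ}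
    (hX : ∀ n, AEMeasurable (X n) (μ n)) (hY : ∀ n, AEMeasurable (Y n) (μ n))
    (hε : Tendsto ε atTop (nhds 0)) (h : ∀ n ω, |X n ω - Y n ω| ≤ ε n) {t : ℝ} {z : ℂ}
    (hlim : Tendsto (fun n => ∫ ω, Complex.exp (t * Y n ω * Complex.I) ∂μ n) atTop (nhds z)) :
    Tendsto (fun n => ∫ ω, Complex.exp (t * X n ω * Complex.I) ∂μ n) atTop (nhds z) := by
  have hint (n : ℕ) (Z : Ω n → ℝ) (hZ : AEMeasurable Z (μ n)) :
      Integrable (fun ω => Complex.exp (t * Z ω * Complex.I)) (μ n) := by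
    refine Integrable.of_bound (by fun_prop) 1 (Eventually.of_forall fun ω => ?_)
    rw [← Complex.ofReal_mul, Complex.norm_exp_ofReal_mul_I]
  refine tendsto_of_tendsto_of_dist hlim ?_
  refine squeeze_zero (fun _ => dist_nonneg) (fun n => ?_)
    (g := fun n => |t| * ε n) (by simpa using hε.const_mul |t|)
  rw [dist_comm, dist_eq_norm, ← integral_sub (hint n _ (hX n)) (hint n _ (hY n))]
  refine (norm_integral_le_of_norm_le_const (C := |t| * ε n)
    (Eventually.of_forall fun ω => ?_)).trans (by simp)
  rw [← Complex.ofReal_mul, ← Complex.ofReal_mul]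
  refine (norm_exp_mul_I_sub_exp_mul_I_le _ _).trans ?_
  rw [← mul_sub, abs_mul]
  exact mul_le_mul_of_nonneg_left (h n ω) (abs_nonneg t)

theorem mainTheorem2 (g : ℕ → Strategy) (hg : ∀ n : ℕ, IsOptimal n (g n)) :
    TendstoInDistribution
      (fun (n : ℕ) (ω : Fin n → Bool) =>
        ((numCorrect n (g n) ω : ℝ) - 3 / 4 * (n : ℝ)) / (Real.sqrt n / 4))
      atTop (id : ℝ → ℝ) coinMeasure (gaussianReal 0 1) where
  forall_aemeasurable n := (measurable_of_finite _).aemeasurable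
  aemeasurable_limit := aemeasurable_id
  tendsto := by
    refine ProbabilityMeasure.tendsto_iff_tendsto_charFun.2 fun t => ?_
    have hsqrt : Tendsto (fun n : ℕ => 10 * (Real.sqrt n)⁻¹) atTop (nhds 0) := by
      simpa using (tendsto_inv_atTop_zero.comp
        (Real.tendsto_sqrt_atTop.comp tendsto_natCast_atTop_atTop)).const_mul (10 : ℝ)
    -- The two side goals say that the sign has mean 0 and second moment 1.
    have hlim := tendsto_charFun_inv_sqrt_mul_pow
      (P := (PMF.uniformOfFintype Bool).toMeasure) (X := coinSign)
      (measurable_of_finite _).aemeasurable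
      (by rw [integral_uniform_bool]; simp [coinSign])
      (by rw [integral_uniform_bool]; simp [coinSign]) t
    simp only [← integral_exp_sum_coinSign] at hlim
    have := tendsto_integral_exp_of_abs_sub_le (fun n => (measurable_of_finite _).aemeasurable)
      (fun n => (measurable_of_finite _).aemeasurable) hsqrt
      (fun n ω => abs_normalized_numCorrect_sub_le (hg n) ω) hlim
    simp only [ProbabilityMeasure.coe_mk, Measure.map_id, charFun_gaussianReal]
    convert! this using 2 with n
    · rw [charFun_apply_real, integral_map (measurable_of_finite _).aemeasurable (by fun_prop)]
    · congr 1
      simp [neg_div]
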